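/- Let $\Gamma$ be a finite dynamic game with perfect recall (simultaneous moves allowed): finitely many players $i\in I$, a finite arborescence of histories (finite sequences of action profiles) in which the action profiles feasible at a nonterminal history form a product $\prod_i A_i(x)$, terminal histories $Z$, for every player $i$ a family $H_i$ of information sets partitioning the histories at which $i$ is active (has at least two actions), and a complete and transitive preference relation $\succsim_i$ on $Z$. Let $S_i$ be the set of strategies of $i$ (behavioral equivalence classes of standard strategies), $S=\prod_j S_j$, $S_{-i}=\prod_{j\ne i}S_j$, and let $\zeta(s)\in Z$ be the outcome of $s\in S$. For an information set $h$, let $S_i(h)$ and $S_{-i}(h)$ be the projections on $S_i$ and $S_{-i}$ of the set of profiles whose outcome passes through $h$, and let $H_i(s_i)=\{h\in H_i : s_i\in S_i(h)\}$. For a product set $R=\prod_jR_j\subseteq S$ with $R_{-i}=\prod_{j\neq i}R_j$, let $R_i(h)=R_i\cap S_i(h)$, $R_{-i}(h)=R_{-i}\cap S_{-i}(h)$ and $R^i(h)=R_i(h)\times R_{-i}(h)$. Let $\mathcal U_i$ be the set of functions $u_i:Z\to\mathbb R$ with $u_i(z)\ge u_i(z')\iff z\succsim_i z'$. *Iterative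 Conditional B-Dominance (ICBD).* For $P\subseteq S_i$ and $Q\subseteq S_{-i}$, a strategy $s_i\in P$ is B-dominated with respect to $P\times Q$ if for every nonempty subset $Q'\subseteq Q$ some $t_i\in P$ weakly dominates $s_i$ on $Q'$, that is, $\zeta(t_i,q)\succsim_i\zeta(s_i,q)$ for all $q\in Q'$, with strict preference for some $q\in Q'$. Let $\mathbb U_i(R)$ be the set of $s_i\in R_i$ such that, for every $h\in H_i(s_i)$ with $R^i(h)\ne\emptyset$, $s_i$ is not B-dominated with respect to $R^i(h)$. Put $\mathbb U(R)=\prod_j\mathbb U_j(R)$, $\mathbb U^0(S)=S$ and $\mathbb U^{k+1}(S)=\mathbb U(\mathbb U^k(S))$; $\mathbb U^k_i(S)$ is the $i$-th factor of $\mathbb U^k(S)$. *Strong Rationalizability.* A conditional probability system (CPS) $\mu_i$ assigns to every event $E\in\mathcal H_i=\{S_{-i}(h):h\in H_i\}$ a probability measure $\mu_i(\cdot\mid E)$ on $S_{-i}$ with $\mu_i(E\mid E)=1$, such that $\mu_i(B\mid E)=\mu_i(B\mid E')\,\mu_i(E'\mid E)$ whenever $B\subseteq E'\subseteq E$ and $E,E'\in\mathcal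 H_i$. Let $\Delta^{\mathcal H_i}(R_{-i})$ be the set of CPSs with $\mu_i(R_{-i}(h)\mid S_{-i}(h))=1$ for every $h\in H_i$ with $R^i(h)\neq\emptyset$. For a utility profile $u=(u_j)_{j\in I}$, let $\mathbb R_i(R)[u]$ be the set of $s_i\in R_i$ for which there is $\mu_i\in\Delta^{\mathcal H_i}(R_{-i})$ such that, for every $h\in H_i(s_i)$ with $R^i(h)\neq\emptyset$, $s_i$ maximizes $\sum_{q\in S_{-i}}u_i(\zeta(t_i,q))\,\mu_i(\{q\}\mid S_{-i}(h))$ over $t_i\in S_i(h)$. Put $\mathbb R(R)[u]=\prod_j\mathbb R_j(R)[u]$, $\mathbb R^0(S)[u]=S$ and $\mathbb R^{k+1}(S)[u]=\mathbb R(\mathbb R^k(S)[u])[u]$, with $i$-th factor $\mathbb R_i^{k+1}(S)[u]$. **Theorem.** For every such game there is a profile $u^*=(u^*_i)_{i\in I}$ with $u_i^*\in\mathcal U_i$ for every $i\in I$ such that $$\mathbb U^k_i(S)=\mathbb R^k_i(S)[u^*]\qquad\text{for every } i\in I \text{ and every } k\in\mathbb N .$$ -/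

import Mathlib

noncomputable section

universe uI uA

/-- The arborescence of a finite extensive form with (possibly) simultaneous moves. A history is a
finite sequence of action profiles; `[]` is the initial history. -/
structure GameTree (I : Type uI) (A : I → Type uA) where
  /-- the set of histories -/
  X : Set (List (∀ i, A i))
  finite_X : X.Finite
  nil_mem : [] ∈ X
  prefix_closed : ∀ x a, x ++ [a] ∈ X → x ∈ X
  /-- at a nonterminal history the feasible action profiles form a product `∏ i, A_i(x)` -/
  product_actions : ∀ (x : List (∀ i, A i)) (a b : ∀ i, A i), x ++ [b] ∈ X →
    (∀ i, ∃ c : ∀ j, A j, x ++ [c] ∈ X ∧ c i = a i) → x ++ [a] ∈ X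

namespace GameTree

variable {I : Type uI} {A : I → Type uA} (T : GameTree I A)

/-- `A_i(x)`: the actions of player `i` available at history `x`. -/
def avail (i : I) (x : List (∀ i, A i)) : Set (A i) :=
  {b | ∃ a : ∀ j, A j, x ++ [a] ∈ T.X ∧ a i = b}

/-- Player `i` is active at `x` if she has at least two available actions there. -/
def Active (i : I) (x : List (∀ i, A i)) : Prop :=
  x ∈ T.X ∧ (T.avail i x).Nontrivial

/-- `Z`: the terminal histories, or outcomes. -/
def Terminal : Type (max uI uA) :=
  {z : List (∀ i, A i) // z ∈ T.X ∧ ∀ a, z ++ [a] ∉ T.X}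

end GameTree

/-- A finite dynamic game with ordinal preferences and perfect recall. -/
structure DynamicGame (I : Type uI) (A : I → Type uA) extends GameTree I A where
  /-- `H_i`: the information sets of player `i`, a partition of the histories where `i` is active -/
  infoSets : I → Set (Set (List (∀ i, A i)))
  info_nonempty : ∀ i, ∀ h ∈ infoSets i, h.Nonempty
  info_active : ∀ i, ∀ h ∈ infoSets i, ∀ x ∈ h, toGameTree.Active i x
  info_partition : ∀ i x, toGameTree.Active i x → ∃! h, h ∈ infoSets i ∧ x ∈ h
  info_avail : ∀ i, ∀ h ∈ infoSets i, ∀ x ∈ h, ∀ x' ∈ h,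
    toGameTree.avail i x = toGameTree.avail i x'
  /-- Perfect recall: if on the way to `x` player `i` passed through her information set `g` and
  chose some action there, then on the way to any `x'` that she cannot distinguish from `x` she also
  passed through `g` and chose that same action. -/
  perfect_recall : ∀ i, ∀ h ∈ infoSets i, ∀ x ∈ h, ∀ x' ∈ h,
    ∀ g ∈ infoSets i, ∀ y ∈ g, ∀ a : ∀ j, A j, y ++ [a] <+: x →
      ∃ y' ∈ g, ∃ a' : ∀ j, A j, y' ++ [a'] <+: x' ∧ a' i = a i
  /-- `pref i z z'` means that player `i` weakly prefers `z` to `z'` -/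
  pref : I → toGameTree.Terminal → toGameTree.Terminal → Prop
  pref_total : ∀ i z z', pref i z z' ∨ pref i z' z
  pref_trans : ∀ i z z' z'', pref i z z' → pref i z' z'' → pref i z z''

namespace DynamicGame

variable {I : Type uI} {A : I → Type uA} (Γ : DynamicGame I A)

/-! ### Standard strategies and outcomes -/

/-- Standard strategies of player `i`. -/
def StdStrategy (i : I) : Type (max uI uA) :=
  {s : Γ.infoSets i → A i // ∀ h : Γ.infoSets i, ∀ x ∈ h.1, s h ∈ Γ.avail i x}

/-- History `x` is consistent with the profile `s`: along `x`, every active player takes the action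
that her strategy prescribes at her current information set. -/
def Follows (s : ∀ i, Γ.StdStrategy i) (x : List (∀ i, A i)) : Prop :=
  x ∈ Γ.X ∧ ∀ y a, y ++ [a] <+: x → ∀ i (h : Γ.infoSets i), y ∈ h.1 → a i = (s i).1 h

theorem mem_of_prefix {x y : List (∀ i, A i)} (hx : x ∈ Γ.X) (h : y <+: x) : y ∈ Γ.X := by
  obtain ⟨t, rfl⟩ := h
  induction t using List.reverseRecOn with
  | nil => simpa using hx
  | append_singleton t a ih =>
    apply ih
    apply Γ.prefix_closed _ a
    simpa using hx

theorem exists_next (s : ∀ i, Γ.StdStrategy i) {x : List (∀ i, A i)} {b : ∀ i, A i}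
    (hb : x ++ [b] ∈ Γ.X) :
    ∃ a, x ++ [a] ∈ Γ.X ∧ ∀ i (h : Γ.infoSets i), x ∈ h.1 → a i = (s i).1 h := by
  classical
  have hx : x ∈ Γ.X := Γ.prefix_closed _ _ hb
  have key : ∀ i, ∃ c : A i, c ∈ Γ.avail i x ∧
      ∀ h : Γ.infoSets i, x ∈ h.1 → c = (s i).1 h := by
    intro i
    by_cases hi : ∃ h : Γ.infoSets i, x ∈ h.1
    · obtain ⟨h, hxh⟩ := hi
      refine ⟨(s i).1 h, (s i).2 h x hxh, fun h' hxh' => ?_⟩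
      have hu := Γ.info_partition i x (Γ.info_active i h.1 h.2 x hxh)
      rw [Subtype.ext (hu.unique ⟨h.2, hxh⟩ ⟨h'.2, hxh'⟩)]
    · exact ⟨b i, ⟨b, hb, rfl⟩, fun h hxh => absurd ⟨h, hxh⟩ hi⟩
  choose a ha using key
  exact ⟨a, Γ.product_actions x a b hb (fun i => (ha i).1), fun i => (ha i).2⟩

theorem unique_next (s : ∀ i, Γ.StdStrategy i) {x : List (∀ i, A i)} {a b : ∀ i, A i}
    (ha : x ++ [a] ∈ Γ.X) (hb : x ++ [b] ∈ Γ.X)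
    (ha' : ∀ i (h : Γ.infoSets i), x ∈ h.1 → a i = (s i).1 h)
    (hb' : ∀ i (h : Γ.infoSets i), x ∈ h.1 → b i = (s i).1 h) : a = b := by
  funext i
  by_cases hn : (Γ.avail i x).Nontrivial
  · obtain ⟨h, ⟨hh, hxh⟩, -⟩ := Γ.info_partition i x ⟨Γ.prefix_closed _ _ ha, hn⟩
    rw [ha' i ⟨h, hh⟩ hxh, hb' i ⟨h, hh⟩ hxh]
  · rw [Set.not_nontrivial_iff] at hn
    exact hn ⟨a, ha, rfl⟩ ⟨b, hb, rfl⟩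

theorem exists_terminal_follows (s : ∀ i, Γ.StdStrategy i) :
    ∃ z : Γ.Terminal, Γ.Follows s z.1 := by
  have hfin : {x | Γ.Follows s x}.Finite := Γ.finite_X.subset (fun x hx => hx.1)
  have hne : {x | Γ.Follows s x}.Nonempty :=
    ⟨[], Γ.nil_mem, fun y a h => by simp at h⟩
  obtain ⟨z, hz, hmax⟩ := Set.exists_max_image _ List.length hfin hne
  refine ⟨⟨z, hz.1, fun b hb => ?_⟩, hz⟩
  obtain ⟨a, haX, ha⟩ := Γ.exists_next s hb
  have hf : Γ.Follows s (z ++ [a]) := by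
    refine ⟨haX, fun y c hyc i h hy => ?_⟩
    rcases List.prefix_concat_iff.1 hyc with heq | hpre
    · obtain ⟨rfl, hc⟩ := List.append_inj' heq rfl
      simp only [List.cons.injEq, and_true] at hc
      subst hc
      exact ha i h hy
    · exact hz.2 y c hpre i h hy
  have := hmax _ hf
  simp at this

theorem follows_prefix (s : ∀ i, Γ.StdStrategy i) (z z' : Γ.Terminal)
    (hz : Γ.Follows s z.1) (hz' : Γ.Follows s z'.1) :
    ∀ x, x <+: z.1 → x <+: z'.1 := by
  intro x
  induction x using List.reverseRecOn with
  | nil => intro _; exact List.nil_prefix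
  | append_singleton x a ih =>
    intro hx
    have hx' : x <+: z'.1 := ih ((List.prefix_append x [a]).trans hx)
    have haX : x ++ [a] ∈ Γ.X := Γ.mem_of_prefix hz.1 hx
    obtain ⟨t, ht⟩ := hx'
    cases t with
    | nil =>
      exfalso
      apply z'.2.2 a
      rw [← ht]
      simpa using haX
    | cons b t =>
      have hb : x ++ [b] <+: z'.1 := ⟨t, by rw [← ht]; simp⟩
      have hab : a = b := Γ.unique_next s haX (Γ.mem_of_prefix hz'.1 hb)
        (hz.2 x a hx) (hz'.2 x b hb)
      rw [hab]
      exact hb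

theorem follows_unique (s : ∀ i, Γ.StdStrategy i) (z z' : Γ.Terminal)
    (hz : Γ.Follows s z.1) (hz' : Γ.Follows s z'.1) : z = z' := by
  apply Subtype.ext
  have h1 := Γ.follows_prefix s z z' hz hz' z.1 List.prefix_rfl
  have h2 := Γ.follows_prefix s z' z hz' hz z'.1 List.prefix_rfl
  exact h1.eq_of_length_le h2.length_le

/-- The outcome function `ζ` on standard strategy profiles: the terminal history induced by `s`. -/
def stdOutcome (s : ∀ i, Γ.StdStrategy i) : Γ.Terminal :=
  (Γ.exists_terminal_follows s).choose

theorem stdOutcome_follows (s : ∀ i, Γ.StdStrategy i) : Γ.Follows s (Γ.stdOutcome s).1 :=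
  (Γ.exists_terminal_follows s).choose_spec

/-! ### Strategies (behavioural equivalence classes of standard strategies) -/

/-- The standard strategy `si` of player `i` reaches `h`: some profile containing `si` induces an
outcome that passes through `h`. -/
def StdReaches {i : I} (si : Γ.StdStrategy i) (h : Set (List (∀ i, A i))) : Prop :=
  ∃ s : ∀ j, Γ.StdStrategy j, s i = si ∧ ∃ x ∈ h, x <+: (Γ.stdOutcome s).1

/-- `H`: the information sets of all the players. -/
def allInfoSets : Set (Set (List (∀ i, A i))) := ⋃ i, Γ.infoSets i

/-- `H(si)`: the information sets (of all the players) that are allowed by `si`. -/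
def stdAllowed {i : I} (si : Γ.StdStrategy i) : Set (Set (List (∀ i, A i))) :=
  {h ∈ Γ.allInfoSets | Γ.StdReaches si h}

/-- Behavioural equivalence of standard strategies. -/
def behaviorSetoid (i : I) : Setoid (Γ.StdStrategy i) where
  r s t := Γ.stdAllowed s = Γ.stdAllowed t ∧
    ∀ h : Γ.infoSets i, h.1 ∈ Γ.stdAllowed s → s.1 h = t.1 h
  iseqv :=
    { refl := fun _ => ⟨rfl, fun _ _ => rfl⟩
      symm := fun h => ⟨h.1.symm, fun g hg => (h.2 g (h.1 ▸ hg)).symm⟩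
      trans := fun h k => ⟨h.1.trans k.1,
        fun g hg => (h.2 g hg).trans (k.2 g (h.1 ▸ hg))⟩ }

/-- `S_i`: the strategies of player `i`. -/
def Strategy (i : I) : Type (max uI uA) := Quotient (Γ.behaviorSetoid i)

/-- The outcome function `ζ` on strategy profiles; by `outcome_mk` it does not depend on the
representatives. -/
def outcome (s : ∀ i, Γ.Strategy i) : Γ.Terminal :=
  Γ.stdOutcome (fun i => Quotient.out (s i))

theorem stdOutcome_congr (s t : ∀ i, Γ.StdStrategy i)
    (hst : ∀ i, Γ.behaviorSetoid i (s i) (t i)) : Γ.stdOutcome s = Γ.stdOutcome t := by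
  have hs := Γ.stdOutcome_follows s
  refine Γ.follows_unique t _ _ ⟨hs.1, fun y a hya i h hy => ?_⟩ (Γ.stdOutcome_follows t)
  rw [hs.2 y a hya i h hy]
  exact (hst i).2 h ⟨Set.mem_iUnion.2 ⟨i, h.2⟩, s, rfl, y, hy,
    (List.prefix_append y [a]).trans hya⟩

theorem outcome_mk (s : ∀ i, Γ.StdStrategy i) :
    Γ.outcome (fun i => Quotient.mk (Γ.behaviorSetoid i) (s i)) = Γ.stdOutcome s :=
  Γ.stdOutcome_congr _ _ (fun i => Quotient.mk_out (s := Γ.behaviorSetoid i) (s i))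

/-- `S_{-i}`: the strategy profiles of the players other than `i`. -/
def Opp (i : I) : Type (max uI uA) := ∀ j : {j : I // j ≠ i}, Γ.Strategy j.1

/-- The profile `(si, q)`. -/
def glue [DecidableEq I] (i : I) (si : Γ.Strategy i) (q : Γ.Opp i) : ∀ j, Γ.Strategy j :=
  fun j => if h : j = i then h ▸ si else q ⟨j, h⟩

/-- `S(h)`: the strategy profiles that reach `h`. -/
def reach (h : Set (List (∀ i, A i))) : Set (∀ i, Γ.Strategy i) :=
  {s | ∃ x ∈ h, x <+: (Γ.outcome s).1}

/-- `S_i(h)`, the projection of `S(h)` on `S_i`. -/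
def reachOwn (i : I) (h : Set (List (∀ i, A i))) : Set (Γ.Strategy i) :=
  (fun s : ∀ j, Γ.Strategy j => s i) '' Γ.reach h

/-- `S_{-i}(h)`, the projection of `S(h)` on `S_{-i}`. -/
def reachOpp (i : I) (h : Set (List (∀ i, A i))) : Set (Γ.Opp i) :=
  (fun (s : ∀ j, Γ.Strategy j) (j : {j : I // j ≠ i}) => s j.1) '' Γ.reach h

/-! ### Restrictions

A product set `R = ∏ j, R_j` of strategy profiles is represented by the family of its factors. -/

/-- `R_i(h) = R_i ∩ S_i(h)`. -/
def restOwn (R : ∀ j, Set (Γ.Strategy j)) (i : I) (h : Set (List (∀ i, A i))) :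
    Set (Γ.Strategy i) := R i ∩ Γ.reachOwn i h

/-- `R_{-i}(h) = R_{-i} ∩ S_{-i}(h)`. -/
def restOpp (R : ∀ j, Set (Γ.Strategy j)) (i : I) (h : Set (List (∀ i, A i))) :
    Set (Γ.Opp i) := {q | ∀ j, q j ∈ R j.1} ∩ Γ.reachOpp i h

/-- `R^i(h) = R_i(h) × R_{-i}(h)`. -/
def condProblem (R : ∀ j, Set (Γ.Strategy j)) (i : I) (h : Set (List (∀ i, A i))) :
    Set (Γ.Strategy i × Γ.Opp i) := Γ.restOwn R i h ×ˢ Γ.restOpp R i h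

section Procedures

variable [DecidableEq I]

/-! ### Conditional B-dominance and its iteration -/

/-- `t` weakly dominates `s` for player `i` relative to the opponents' profiles in `Q`. -/
def WeaklyDominates (i : I) (Q : Set (Γ.Opp i)) (t s : Γ.Strategy i) : Prop :=
  (∀ q ∈ Q, Γ.pref i (Γ.outcome (Γ.glue i t q)) (Γ.outcome (Γ.glue i s q))) ∧
  ∃ q ∈ Q, Γ.pref i (Γ.outcome (Γ.glue i t q)) (Γ.outcome (Γ.glue i s q)) ∧
    ¬ Γ.pref i (Γ.outcome (Γ.glue i s q)) (Γ.outcome (Γ.glue i t q))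

/-- The strategies in `P` that are admissible with respect to `P × Q`. -/
def admissible (i : I) (P : Set (Γ.Strategy i)) (Q : Set (Γ.Opp i)) : Set (Γ.Strategy i) :=
  {s ∈ P | ∀ t ∈ P, ¬ Γ.WeaklyDominates i Q t s}

/-- The strategies in `P` that are B-dominated with respect to `P × Q`. -/
def bDominated (i : I) (P : Set (Γ.Strategy i)) (Q : Set (Γ.Opp i)) : Set (Γ.Strategy i) :=
  {s ∈ P | ∀ Q' ⊆ Q, Q'.Nonempty → s ∉ Γ.admissible i P Q'}

/-- `𝕌_i(R)`: the strategies in `R_i` that are not conditionally B-dominated with respect to `R`. -/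
def opU (R : ∀ j, Set (Γ.Strategy j)) (i : I) : Set (Γ.Strategy i) :=
  {s ∈ R i | ∀ h ∈ Γ.infoSets i, s ∈ Γ.reachOwn i h → (Γ.condProblem R i h).Nonempty →
    s ∉ Γ.bDominated i (Γ.restOwn R i h) (Γ.restOpp R i h)}

/-- `𝕌^k(S)`: the `k`-th round of Iterative Conditional B-Dominance. -/
def icbd : ℕ → ∀ i, Set (Γ.Strategy i)
  | 0 => fun _ => Set.univ
  | k + 1 => Γ.opU (icbd k)

/-! ### Conditional probability systems and Strong Rationalizability -/

/-- `𝓗_i = {S_{-i}(h) | h ∈ H_i}`: the conditioning events of player `i`. -/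
def condEvents (i : I) : Set (Set (Γ.Opp i)) := Γ.reachOpp i '' Γ.infoSets i

variable [Finite I] [∀ i, Finite (A i)]

instance finite_strategy (i : I) : Finite (Γ.Strategy i) := by
  have h1 : (Γ.infoSets i).Finite := Γ.finite_X.powerset.subset
    (fun h hh x hx => (Γ.info_active i h hh x hx).1)
  have h2 : Finite (Γ.infoSets i) := h1
  have h3 : Finite (Γ.StdStrategy i) := by unfold StdStrategy; infer_instance
  unfold Strategy
  infer_instance

instance fintype_opp (i : I) : Fintype (Γ.Opp i) :=
  have : Finite (Γ.Opp i) := by unfold Opp; infer_instance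
  Fintype.ofFinite _

/-- The probability of the event `E` under the probability weights `p`. -/
def prob {i : I} (p : Γ.Opp i → ℝ) (E : Set (Γ.Opp i)) : ℝ := ∑ q, E.indicator p q

/-- Conditional probability systems of player `i`: `μ E` is the vector of weights of the probability
measure `μ_i(· | E)` on the finite set `S_{-i}`, for every conditioning event `E`. -/
structure IsCPS (i : I) (μ : Γ.condEvents i → Γ.Opp i → ℝ) : Prop where
  measure : ∀ E, μ E ∈ stdSimplex ℝ (Γ.Opp i)
  self : ∀ E, Γ.prob (μ E) E.1 = 1
  chain : ∀ (E E' : Γ.condEvents i) (B : Set (Γ.Opp i)), B ⊆ E'.1 → E'.1 ⊆ E.1 →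
    Γ.prob (μ E) B = Γ.prob (μ E') B * Γ.prob (μ E) E'.1

/-- The conditioning event `S_{-i}(h)` of the information set `h` of player `i`. -/
def event {i : I} (h : Γ.infoSets i) : Γ.condEvents i :=
  ⟨Γ.reachOpp i h.1, Set.mem_image_of_mem _ h.2⟩

/-- `Δ^{𝓗_i}(R_{-i})`: the CPSs that, at every `h ∈ H_i` with `R^i(h)` nonempty, are certain of
`R_{-i}(h)`. -/
def cpsOn (R : ∀ j, Set (Γ.Strategy j)) (i : I) : Set (Γ.condEvents i → Γ.Opp i → ℝ) :=
  {μ | Γ.IsCPS i μ ∧ ∀ h : Γ.infoSets i, (Γ.condProblem R i h.1).Nonempty →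
    Γ.prob (μ (Γ.event h)) (Γ.restOpp R i h.1) = 1}

/-- Expected utility of the strategy `s` of player `i` under the Bernoulli utility function `ui` and
the probability weights `p`. -/
def expUtility (i : I) (ui : Γ.Terminal → ℝ) (s : Γ.Strategy i) (p : Γ.Opp i → ℝ) : ℝ :=
  ∑ q, ui (Γ.outcome (Γ.glue i s q)) * p q

/-- `ℝ_i(R)[u]`: the strategies in `R_i` that, for some CPS in `Δ^{𝓗_i}(R_{-i})`, maximize expected
utility among the strategies in `S_i(h)` at every `h ∈ H_i` that they allow with `R^i(h)` nonempty. -/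
def opR (u : I → Γ.Terminal → ℝ) (R : ∀ j, Set (Γ.Strategy j)) (i : I) :
    Set (Γ.Strategy i) :=
  {s ∈ R i | ∃ μ ∈ Γ.cpsOn R i, ∀ h : Γ.infoSets i, s ∈ Γ.reachOwn i h.1 →
    (Γ.condProblem R i h.1).Nonempty → ∀ t ∈ Γ.reachOwn i h.1,
      Γ.expUtility i (u i) t (μ (Γ.event h)) ≤ Γ.expUtility i (u i) s (μ (Γ.event h))}

/-- `ℝ^k(S)[u]`: the `k`-th round of Strong Rationalizability under the utility profile `u`. -/
def strongRat (u : I → Γ.Terminal → ℝ) : ℕ → ∀ i, Set (Γ.Strategy i)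
  | 0 => fun _ => Set.univ
  | k + 1 => Γ.opR u (strongRat u k)

end Procedures

/-- `𝓤_i`: the Bernoulli utility functions that represent the preference relation of player `i`. -/
def utilities (i : I) : Set (Γ.Terminal → ℝ) :=
  {ui | ∀ z z', ui z' ≤ ui z ↔ Γ.pref i z z'}

end DynamicGame

end

noncomputable section

universe uI uA

namespace DynamicGame

section

/-! ### Histories consistent with a strategy profile. -/

variable {I : Type uI} {A : I → Type uA} (Γ : DynamicGame I A)

/-! The utilities are extremely risk averse: `powUtility` is `-M ^ (-rank)`, with `M` at least the
number of opponents' profiles. By induction on the round it suffices that the two one-step operators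
agree on `R`, the `k`-th round of Strong Rationalizability.

One inclusion (`opR_subset_opU`) needs only that utilities represent preferences: against the
support of a belief to which `s` is a best reply, nothing in `R_i(h)` weakly dominates `s`.

For the other (`opU_subset_opR`), give each opponents' profile `q` the weight `w q = M ^ rank (ζ (s,
q))`, so that `s` earns exactly `-1` against each. A strategy doing worse than `s` at some `q ∈ Q`
loses at least `M` there, more than `s` can lose on all of `Q`. Hence `s` is optimal within `P`
against `w` on every `Q` for which it is admissible in `P × Q` (`value_le_value_of_admissible`). The
weights depend neither on `Q` nor on the information set, so a CPS arises by ordering profiles into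
levels and conditioning `w` on the lowest level compatible with each event (`isCPS_levelBelief`).

The levels are built from the root of the game onwards: at an information set `h` not yet reached by
the profiles already placed, B-undominance supplies a set `Q ⊆ R_{-i}(h)`, which becomes the next
level (`PartialLevels.insert`). Admissibility compares `s` only with strategies in `R_i(h)`, while
rationality needs all of `S_i(h)`. `PartialLevels.exists_better` closes the gap: if anything in
`S_i(h)` beats `s` against `Q`, then so does a lexicographic maximizer along the levels, and that
strategy survives all `k` rounds. Perfect recall enters through `glue_mem_reach` and
`exists_replacement`. -/

theorem Follows.of_prefix {Γ : DynamicGame I A} {s : ∀ i, Γ.StdStrategy i}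
    {x y : List (∀ i, A i)} (hx : Γ.Follows s x) (h : y <+: x) : Γ.Follows s y :=
  ⟨Γ.mem_of_prefix hx.1 h, fun _ _ hw => hx.2 _ _ (hw.trans h)⟩

theorem Follows.prefix_stdOutcome {Γ : DynamicGame I A} {s : ∀ i, Γ.StdStrategy i}
    {x : List (∀ i, A i)} (hx : Γ.Follows s x) : x <+: (Γ.stdOutcome s).1 := by
  induction x using List.reverseRecOn with
  | nil => exact List.nil_prefix
  | append_singleton x a ih =>
    obtain ⟨t, ht⟩ := ih (hx.of_prefix (List.prefix_append x [a]))
    have hz := Γ.stdOutcome_follows s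
    cases t with
    | nil =>
      refine absurd ?_ ((Γ.stdOutcome s).2.2 a)
      rw [← ht]
      simpa using hx.1
    | cons b t =>
      have hb : x ++ [b] <+: (Γ.stdOutcome s).1 := ⟨t, by rw [← ht]; simp⟩
      rwa [Γ.unique_next s hx.1 (Γ.mem_of_prefix hz.1 hb) (hx.2 x a List.prefix_rfl)
        (hz.2 x b hb)]

theorem follows_iff_prefix (s : ∀ i, Γ.StdStrategy i) (x : List (∀ i, A i)) :
    Γ.Follows s x ↔ x <+: (Γ.stdOutcome s).1 :=
  ⟨fun h => h.prefix_stdOutcome, fun h => (Γ.stdOutcome_follows s).of_prefix h⟩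

theorem stdOutcome_eq_of_follows {s t : ∀ i, Γ.StdStrategy i}
    (h : Γ.Follows s (Γ.stdOutcome t).1) : Γ.stdOutcome s = Γ.stdOutcome t :=
  Γ.follows_unique s _ _ (Γ.stdOutcome_follows s) h

/-! ### Precedence of information sets -/

/-- Some history in `h` strictly extends a history in `g`. -/
def Precedes (g h : Set (List (∀ i, A i))) : Prop :=
  ∃ y ∈ g, ∃ x ∈ h, ∃ a, y ++ [a] <+: x

/-- The least length of a history in `h`. -/
def depth (h : Set (List (∀ i, A i))) : ℕ := sInf (List.length '' h)

variable {Γ} in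
theorem Precedes.exists_prefix {i : I} {g h : Set (List (∀ i, A i))} (hg : g ∈ Γ.infoSets i)
    (hh : h ∈ Γ.infoSets i) (hgh : Precedes g h) {x : List (∀ i, A i)} (hx : x ∈ h) :
    ∃ y ∈ g, ∃ a, y ++ [a] <+: x := by
  obtain ⟨y, hy, x', hx', a, ha⟩ := hgh
  obtain ⟨y', hy', a', ha', -⟩ := Γ.perfect_recall i h hh x' hx' x hx g hg y hy a ha
  exact ⟨y', hy', a', ha'⟩

variable {Γ} in
-- By perfect recall even a shortest history of `h` strictly extends one of `g`. Hence precedence is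
-- acyclic, and `depth` can serve for induction.
theorem Precedes.depth_lt {i : I} {g h : Set (List (∀ i, A i))} (hg : g ∈ Γ.infoSets i)
    (hh : h ∈ Γ.infoSets i) (hgh : Precedes g h) : depth g < depth h := by
  obtain ⟨x, hx, hxd⟩ : depth h ∈ List.length '' h :=
    Nat.sInf_mem ((Γ.info_nonempty i h hh).image _)
  obtain ⟨y, hy, a, ha⟩ := hgh.exists_prefix hg hh hx
  have h1 : depth g ≤ y.length := Nat.sInf_le ⟨y, hy, rfl⟩
  have h2 := ha.length_le
  simp at h2
  omega

theorem not_precedes_self {i : I} {h : Set (List (∀ i, A i))} (hh : h ∈ Γ.infoSets i) :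
    ¬ Precedes h h := fun H => lt_irrefl _ (H.depth_lt hh hh)

theorem prefix_cases {x y z : List (∀ i, A i)} (hx : x <+: z) (hy : y <+: z) :
    x = y ∨ (∃ a, x ++ [a] <+: y) ∨ ∃ a, y ++ [a] <+: x := by
  rcases List.prefix_or_prefix_of_prefix hx hy with ⟨t, ht⟩ | ⟨t, ht⟩
  · cases t with
    | nil => left; simpa using ht
    | cons a t => right; left; exact ⟨a, t, by rw [← ht]; simp⟩
  · cases t with
    | nil => left; simpa using ht.symm
    | cons a t => right; right; exact ⟨a, t, by rw [← ht]; simp⟩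

theorem precedes_cases {i : I} {g h : Set (List (∀ i, A i))} (hg : g ∈ Γ.infoSets i)
    (hh : h ∈ Γ.infoSets i) {x y z : List (∀ i, A i)} (hx : x ∈ g) (hy : y ∈ h)
    (hxz : x <+: z) (hyz : y <+: z) : g = h ∨ Precedes g h ∨ Precedes h g := by
  rcases prefix_cases hxz hyz with rfl | ⟨a, ha⟩ | ⟨a, ha⟩
  · exact Or.inl ((Γ.info_partition i x (Γ.info_active i g hg x hx)).unique ⟨hg, hx⟩ ⟨hh, hy⟩)
  · exact Or.inr (Or.inl ⟨x, hx, y, hy, a, ha⟩)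
  · exact Or.inr (Or.inr ⟨y, hy, x, hx, a, ha⟩)

/-- No path meets an information set twice, so the action that `x` dictates there is well defined;
it is available throughout the set. Off the path any available action will do. -/
theorem exists_stdStrategy_follows {x : List (∀ i, A i)} (hx : x ∈ Γ.X) :
    ∃ s : ∀ i, Γ.StdStrategy i, Γ.Follows s x := by
  classical
  have key : ∀ (i : I) (h : Γ.infoSets i), ∃ c : A i, (∀ y ∈ h.1, c ∈ Γ.avail i y) ∧
      ∀ y ∈ h.1, ∀ a, y ++ [a] <+: x → a i = c := by
    intro i h
    by_cases H : ∃ y ∈ h.1, ∃ a, y ++ [a] <+: x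
    · obtain ⟨y, hy, a, ha⟩ := H
      refine ⟨a i, fun y' hy' => ?_, fun y' hy' a' ha' => ?_⟩
      · rw [Γ.info_avail i h.1 h.2 y' hy' y hy]
        exact ⟨a, Γ.mem_of_prefix hx ha, rfl⟩
      · rcases prefix_cases ha ha' with heq | ⟨b, hb⟩ | ⟨b, hb⟩
        · obtain ⟨-, h2⟩ := List.append_inj' heq rfl
          simp only [List.cons.injEq, and_true] at h2
          rw [h2]
        · rcases List.prefix_concat_iff.1 hb with heq | hb
          · obtain ⟨h1, -⟩ := List.append_inj' heq rfl
            exact absurd ⟨y, hy, y', hy', a, h1 ▸ List.prefix_rfl⟩ (Γ.not_precedes_self h.2)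
          · exact absurd ⟨y, hy, y', hy', a, (List.prefix_append _ _).trans hb⟩
              (Γ.not_precedes_self h.2)
        · rcases List.prefix_concat_iff.1 hb with heq | hb
          · obtain ⟨h1, -⟩ := List.append_inj' heq rfl
            exact absurd ⟨y', hy', y, hy, a', h1 ▸ List.prefix_rfl⟩ (Γ.not_precedes_self h.2)
          · exact absurd ⟨y', hy', y, hy, a', (List.prefix_append _ _).trans hb⟩
              (Γ.not_precedes_self h.2)
    · obtain ⟨y, hy⟩ := Γ.info_nonempty i h.1 h.2
      obtain ⟨c, hc⟩ := (Γ.info_active i h.1 h.2 y hy).2.nonempty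
      refine ⟨c, fun y' hy' => ?_, fun y' hy' a' ha' => absurd ⟨y', hy', a', ha'⟩ H⟩
      rwa [Γ.info_avail i h.1 h.2 y' hy' y hy]
  choose c hc1 hc2 using key
  exact ⟨fun i => ⟨c i, hc1 i⟩, hx, fun y a ha i h hy => hc2 i h y hy a ha⟩

/-! ### Profiles of strategies -/

/-- The behavioural equivalence class of a standard strategy. -/
def StdStrategy.toStrategy {Γ : DynamicGame I A} {i : I} (r : Γ.StdStrategy i) : Γ.Strategy i :=
  Quotient.mk (Γ.behaviorSetoid i) r

theorem reach_iff (h : Set (List (∀ i, A i))) (σ : ∀ i, Γ.Strategy i) :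
    σ ∈ Γ.reach h ↔ ∃ x ∈ h, Γ.Follows (fun j => (σ j).out) x := by
  simp only [follows_iff_prefix]
  rfl

theorem reachOpp_nonempty {i : I} {h : Set (List (∀ i, A i))} (hh : h ∈ Γ.infoSets i) :
    (Γ.reachOpp i h).Nonempty := by
  obtain ⟨x, hx⟩ := Γ.info_nonempty i h hh
  obtain ⟨s, hs⟩ := Γ.exists_stdStrategy_follows (Γ.info_active i h hh x hx).1
  refine Set.Nonempty.image _ ⟨fun j => Quotient.mk (Γ.behaviorSetoid j) (s j), x, hx, ?_⟩
  rw [outcome_mk]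
  exact hs.prefix_stdOutcome

theorem Precedes.reachOwn_subset {Γ : DynamicGame I A} {i : I} {g h : Set (List (∀ i, A i))}
    (hg : g ∈ Γ.infoSets i) (hh : h ∈ Γ.infoSets i) (hgh : Precedes g h) :
    Γ.reachOwn i h ⊆ Γ.reachOwn i g := by
  rintro _ ⟨σ, ⟨x, hx, hσ⟩, rfl⟩
  obtain ⟨y, hy, a, ha⟩ := hgh.exists_prefix hg hh hx
  exact ⟨σ, ⟨y, hy, (List.prefix_append _ _).trans (ha.trans hσ)⟩, rfl⟩

theorem Precedes.reachOpp_subset {Γ : DynamicGame I A} {i : I} {g h : Set (List (∀ i, A i))}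
    (hg : g ∈ Γ.infoSets i) (hh : h ∈ Γ.infoSets i) (hgh : Precedes g h) :
    Γ.reachOpp i h ⊆ Γ.reachOpp i g := by
  rintro _ ⟨σ, ⟨x, hx, hσ⟩, rfl⟩
  obtain ⟨y, hy, a, ha⟩ := hgh.exists_prefix hg hh hx
  exact ⟨σ, ⟨y, hy, (List.prefix_append _ _).trans (ha.trans hσ)⟩, rfl⟩

/-! ### Product structure of `S(h)` and replacement of a strategy from `h` onwards. -/

section Glue

variable [DecidableEq I]

@[simp] theorem glue_self (i : I) (s : Γ.Strategy i) (q : Γ.Opp i) : Γ.glue i s q i = s := by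
  simp [glue]

@[simp] theorem glue_coe (i : I) (s : Γ.Strategy i) (q : Γ.Opp i) (j : {j : I // j ≠ i}) :
    Γ.glue i s q j.1 = q j := by
  simp [glue, j.2]

/-- The profile of standard strategies in which `i` plays `r` and the others play
representatives of `q`. -/
def stdGlue (i : I) (r : Γ.StdStrategy i) (q : Γ.Opp i) : ∀ j, Γ.StdStrategy j :=
  fun j => if h : j = i then h ▸ r else (q ⟨j, h⟩).out

@[simp] theorem stdGlue_self (i : I) (r : Γ.StdStrategy i) (q : Γ.Opp i) :
    Γ.stdGlue i r q i = r := by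
  simp [stdGlue]

@[simp] theorem stdGlue_coe (i : I) (r : Γ.StdStrategy i) (q : Γ.Opp i) (j : {j : I // j ≠ i}) :
    Γ.stdGlue i r q j.1 = (q j).out := by
  simp [stdGlue, j.2]

/-- This allows outcomes to be computed with any representative for `i`, the opponents'
representatives being fixed. -/
theorem outcome_glue_mk (i : I) (r : Γ.StdStrategy i) (q : Γ.Opp i) :
    Γ.outcome (Γ.glue i r.toStrategy q) =
      Γ.stdOutcome (Γ.stdGlue i r q) := by
  refine Γ.stdOutcome_congr _ _ fun j => ?_
  by_cases h : j = i
  · subst h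
    rw [glue_self, stdGlue_self]
    exact Quotient.mk_out (s := Γ.behaviorSetoid j) r
  · have h1 := Γ.glue_coe i r.toStrategy q ⟨j, h⟩
    have h2 := Γ.stdGlue_coe i r q ⟨j, h⟩
    simp only at h1 h2
    rw [h1, h2]

theorem outcome_glue (i : I) (s : Γ.Strategy i) (q : Γ.Opp i) :
    Γ.outcome (Γ.glue i s q) = Γ.stdOutcome (Γ.stdGlue i s.out q) := by
  rw [← outcome_glue_mk]
  congr 2
  exact (Quotient.out_eq s).symm

theorem glue_mem_reach_iff (i : I) (h : Set (List (∀ i, A i))) (s : Γ.Strategy i) (q : Γ.Opp i) :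
    Γ.glue i s q ∈ Γ.reach h ↔ ∃ x ∈ h, Γ.Follows (Γ.stdGlue i s.out q) x := by
  simp only [follows_iff_prefix, ← outcome_glue]
  rfl

theorem mem_reachOwn_of_glue {i : I} {h : Set (List (∀ i, A i))} {s : Γ.Strategy i} {q : Γ.Opp i}
    (H : Γ.glue i s q ∈ Γ.reach h) : s ∈ Γ.reachOwn i h :=
  ⟨_, H, by simp⟩

theorem mem_reachOpp_of_glue {i : I} {h : Set (List (∀ i, A i))} {s : Γ.Strategy i} {q : Γ.Opp i}
    (H : Γ.glue i s q ∈ Γ.reach h) : q ∈ Γ.reachOpp i h :=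
  ⟨_, H, by funext j; simp⟩

/-- Under perfect recall `S(h)` is the product of its projections on `S_i` and `S_{-i}`. -/
theorem glue_mem_reach {i : I} {h : Set (List (∀ i, A i))} (hh : h ∈ Γ.infoSets i)
    {s : Γ.Strategy i} {q : Γ.Opp i} (hs : s ∈ Γ.reachOwn i h) (hq : q ∈ Γ.reachOpp i h) :
    Γ.glue i s q ∈ Γ.reach h := by
  obtain ⟨σ, hσ, rfl⟩ := hs
  obtain ⟨τ, hτ, rfl⟩ := hq
  obtain ⟨x, hx, hσx⟩ := (Γ.reach_iff h σ).1 hσ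
  obtain ⟨x', hx', hτx⟩ := (Γ.reach_iff h τ).1 hτ
  -- The path `x'` of `τ` works: the opponents follow it by choice of `τ`, and each move of `i`
  -- along it also occurs along `x`, where it is the move of `σ i`.
  refine (Γ.glue_mem_reach_iff i h (σ i) (fun j => τ j.1)).2 ⟨x', hx', hτx.1, fun y a ha j g hy => ?_⟩
  by_cases hj : j = i
  · subst hj
    obtain ⟨y', hy', a', ha', haa⟩ :=
      Γ.perfect_recall j h hh x' hx' x hx g.1 g.2 y hy a ha
    rw [← haa, hσx.2 y' a' ha' j g hy']
    exact congrArg (fun r => r.1 g) (Γ.stdGlue_self j _ _).symm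
  · have := Γ.stdGlue_coe i (Quotient.out (σ i)) (fun j => τ j.1) ⟨j, hj⟩
    simp only at this
    rw [hτx.2 y a ha j g hy, this]

theorem precedes_cases_of_reach {i : I} {g h : Set (List (∀ i, A i))} (hg : g ∈ Γ.infoSets i)
    (hh : h ∈ Γ.infoSets i) {s : Γ.Strategy i} {q : Γ.Opp i} (hsg : s ∈ Γ.reachOwn i g)
    (hsh : s ∈ Γ.reachOwn i h) (hqg : q ∈ Γ.reachOpp i g) (hqh : q ∈ Γ.reachOpp i h) :
    g = h ∨ Precedes g h ∨ Precedes h g := by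
  obtain ⟨x, hx, hxz⟩ := Γ.glue_mem_reach hg hsg hqg
  obtain ⟨y, hy, hyz⟩ := Γ.glue_mem_reach hh hsh hqh
  exact Γ.precedes_cases hg hh hx hy hxz hyz

/-- The strategy that follows `t` from `h` onwards and `s` elsewhere. -/
theorem exists_replacement {i : I} {h : Set (List (∀ i, A i))} (hh : h ∈ Γ.infoSets i)
    {s t : Γ.Strategy i} (hs : s ∈ Γ.reachOwn i h) (ht : t ∈ Γ.reachOwn i h) :
    ∃ r ∈ Γ.reachOwn i h,
      (∀ q ∈ Γ.reachOpp i h, Γ.outcome (Γ.glue i r q) = Γ.outcome (Γ.glue i t q)) ∧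
      ∀ q ∉ Γ.reachOpp i h, Γ.outcome (Γ.glue i r q) = Γ.outcome (Γ.glue i s q) := by
  classical
  let r : Γ.StdStrategy i :=
    ⟨fun g => if g.1 = h ∨ Precedes h g.1 then t.out.1 g else s.out.1 g, fun g x hx => by
      beta_reduce
      split_ifs
      exacts [t.out.2 g x hx, s.out.2 g x hx]⟩
  have hr1 : ∀ g : Γ.infoSets i, (g.1 = h ∨ Precedes h g.1) → r.1 g = t.out.1 g :=
    fun g hg => if_pos hg
  have hr2 : ∀ g : Γ.infoSets i, ¬ (g.1 = h ∨ Precedes h g.1) → r.1 g = s.out.1 g :=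
    fun g hg => if_neg hg
  have hA : ∀ q ∈ Γ.reachOpp i h, Γ.outcome (Γ.glue i r.toStrategy q) =
      Γ.outcome (Γ.glue i t q) := by
    intro q hq
    rw [outcome_glue_mk, outcome_glue]
    apply Γ.stdOutcome_eq_of_follows
    have hz := Γ.stdOutcome_follows (Γ.stdGlue i t.out q)
    refine ⟨hz.1, fun y a ha j g hy => ?_⟩
    rw [hz.2 y a ha j g hy]
    by_cases hj : j = i
    · subst hj
      rw [stdGlue_self, stdGlue_self]
      obtain ⟨x, hx, hxt⟩ := (Γ.glue_mem_reach_iff j h t q).1 (Γ.glue_mem_reach hh ht hq)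
      obtain ⟨x', hx', hxs⟩ := (Γ.glue_mem_reach_iff j h s q).1 (Γ.glue_mem_reach hh hs hq)
      by_cases hg : g.1 = h ∨ Precedes h g.1
      · rw [hr1 g hg]
      · rw [hr2 g hg]
        -- An information set on the path that is neither `h` nor after `h` is left before `x`;
        -- perfect recall then makes `s` and `t` choose alike there.
        have hgx : y ++ [a] <+: x := by
          have hxz := hxt.prefix_stdOutcome
          rcases prefix_cases ((List.prefix_append y [a]).trans ha) hxz with rfl | ⟨b, hb⟩ | ⟨b, hb⟩
          · exact absurd (Or.inl ((Γ.info_partition j y (Γ.info_active j g.1 g.2 y hy)).unique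
              ⟨g.2, hy⟩ ⟨hh, hx⟩)) hg
          · have := List.prefix_of_prefix_length_le ha (hb.trans hxz) (by simp)
            exact this.trans hb
          · exact absurd (Or.inr ⟨x, hx, y, hy, b, hb⟩) hg
        obtain ⟨y', hy', a', ha', haa⟩ := Γ.perfect_recall j h hh x hx x' hx' g.1 g.2 y hy a hgx
        have h1 := hz.2 y a ha j g hy
        have h2 := hxs.2 y' a' ha' j g hy'
        rw [stdGlue_self] at h1 h2
        rw [← h1, ← haa, h2]
    · have h1 := Γ.stdGlue_coe i t.out q ⟨j, hj⟩
      have h2 := Γ.stdGlue_coe i r q ⟨j, hj⟩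
      simp only at h1 h2
      rw [h1, h2]
  have hB : ∀ q ∉ Γ.reachOpp i h, Γ.outcome (Γ.glue i r.toStrategy q) =
      Γ.outcome (Γ.glue i s q) := by
    intro q hq
    rw [outcome_glue_mk, outcome_glue]
    apply Γ.stdOutcome_eq_of_follows
    have hz := Γ.stdOutcome_follows (Γ.stdGlue i s.out q)
    refine ⟨hz.1, fun y a ha j g hy => ?_⟩
    rw [hz.2 y a ha j g hy]
    by_cases hj : j = i
    · subst hj
      rw [stdGlue_self, stdGlue_self, hr2]
      intro hg
      apply hq
      have hyz : y <+: (Γ.stdOutcome (Γ.stdGlue j s.out q)).1 :=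
        (List.prefix_append _ _).trans ha
      have : Γ.glue j s q ∈ Γ.reach h := by
        rw [glue_mem_reach_iff]
        rcases hg with rfl | hg
        · exact ⟨y, hy, hz.of_prefix hyz⟩
        · obtain ⟨y', hy', b, hb⟩ := hg.exists_prefix hh g.2 hy
          exact ⟨y', hy', hz.of_prefix (((List.prefix_append _ _).trans hb).trans hyz)⟩
      exact Γ.mem_reachOpp_of_glue this
    · have h1 := Γ.stdGlue_coe i s.out q ⟨j, hj⟩
      have h2 := Γ.stdGlue_coe i r q ⟨j, hj⟩
      simp only at h1 h2
      rw [h1, h2]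
  refine ⟨r.toStrategy, ?_, hA, hB⟩
  obtain ⟨q, hq⟩ := Γ.reachOpp_nonempty hh
  have := Γ.glue_mem_reach hh ht hq
  apply Γ.mem_reachOwn_of_glue (q := q)
  rw [reach, Set.mem_ofPred_eq] at this ⊢
  rwa [hA q hq]

end Glue

end

section

/-! ### Level functions -/

/-- The elements of `E` of least level. -/
def topLevel {α : Type*} (lam : α → ℕ) (E : Set α) : Set α := {q ∈ E | ∀ q' ∈ E, lam q ≤ lam q'}

theorem topLevel_nonempty {α : Type*} (lam : α → ℕ) {E : Set α} (hE : E.Nonempty) :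
    (topLevel lam E).Nonempty := by
  obtain ⟨q, hq⟩ := hE
  obtain ⟨q', hq', h⟩ := (measure lam).wf.has_min E ⟨q, hq⟩
  exact ⟨q', hq', fun p hp => not_lt.1 (h p hp)⟩

/-- This is the chain rule for level beliefs: passing to a subevent of positive probability is
ordinary conditioning. -/
theorem topLevel_inter_of_nonempty {α : Type*} (lam : α → ℕ) {E E' : Set α} (h : E' ⊆ E)
    (hne : (E' ∩ topLevel lam E).Nonempty) : topLevel lam E' = E' ∩ topLevel lam E := by
  obtain ⟨p, hp, hpE⟩ := hne
  ext q
  constructor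
  · rintro ⟨hq, hmin⟩
    exact ⟨hq, h hq, fun q' hq' => (hmin p hp).trans (hpE.2 q' hq')⟩
  · rintro ⟨hq, -, hmin⟩
    exact ⟨hq, fun q' hq' => hmin q' (h hq')⟩

theorem topLevel_eq_fiber {α : Type*} (lam : α → ℕ) {E : Set α} {p : α}
    (hp : p ∈ topLevel lam E) : topLevel lam E = {q | lam q = lam p} ∩ E := by
  ext q
  constructor
  · rintro ⟨hq, hmin⟩
    exact ⟨le_antisymm (hmin p hp.1) (hp.2 q hq), hq⟩
  · rintro ⟨hq, hqE⟩
    exact ⟨hqE, fun q' hq' => hq.le.trans (hp.2 q' hq')⟩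

theorem topLevel_subset_of_lt {α : Type*} {lam : α → ℕ} {n : ℕ} {C E : Set α}
    (hC : ∀ q ∈ C, lam q < n) (hC' : ∀ q ∉ C, n ≤ lam q) (hne : (C ∩ E).Nonempty) :
    topLevel lam E ⊆ C := by
  obtain ⟨p, hpC, hpE⟩ := hne
  intro q hq
  by_contra hqC
  exact absurd ((hC' q hqC).trans (hq.2 p hpE)) (not_le.2 (hC p hpC))

/-- `C` occupies the levels below `n`, so rearranging the levels outside `C` cannot affect beliefs
at events that `C` meets. -/
theorem topLevel_congr {α : Type*} {lam lam' : α → ℕ} {n : ℕ} {C E : Set α}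
    (hC : ∀ q ∈ C, lam q < n) (hC' : ∀ q ∉ C, n ≤ lam q) (hC'' : ∀ q ∉ C, n ≤ lam' q)
    (heq : ∀ q ∈ C, lam' q = lam q) (hne : (C ∩ E).Nonempty) :
    topLevel lam' E = topLevel lam E := by
  have h1 := topLevel_subset_of_lt hC hC' hne
  have h2 := topLevel_subset_of_lt (fun q hq => (heq q hq).trans_lt (hC q hq)) hC'' hne
  obtain ⟨p, hpC, hpE⟩ := hne
  ext q
  constructor
  · intro hq
    refine ⟨hq.1, fun q' hq' => ?_⟩
    rw [← heq q (h2 hq)]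
    by_cases hq'C : q' ∈ C
    · exact heq q' hq'C ▸ hq.2 q' hq'
    · exact (((heq q (h2 hq)).trans_lt (hC q (h2 hq))).trans_le (hC' q' hq'C)).le
  · intro hq
    refine ⟨hq.1, fun q' hq' => ?_⟩
    rw [heq q (h1 hq)]
    by_cases hq'C : q' ∈ C
    · exact (heq q' hq'C).symm ▸ hq.2 q' hq'
    · exact ((hC q (h1 hq)).trans_le (hC'' q' hq'C)).le

/-- The level function that puts `Q` at level `n`, right after `C`. -/
def insertLevel {α : Type*} (C Q : Set α) (lam : α → ℕ) (n : ℕ) : α → ℕ :=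
  open Classical in fun q => if q ∈ C then lam q else if q ∈ Q then n else n + 1 + lam q

section InsertLevel

variable {α : Type*} {C Q : Set α} {lam : α → ℕ} {n : ℕ} {q : α}

theorem insertLevel_of_mem (hq : q ∈ C) : insertLevel C Q lam n q = lam q :=
  if_pos hq

theorem insertLevel_of_mem_right (hq : q ∉ C) (hQ : q ∈ Q) :
    insertLevel C Q lam n q = n := by
  rw [insertLevel, if_neg hq, if_pos hQ]

theorem insertLevel_of_notMem (hq : q ∉ C) (hQ : q ∉ Q) :
    insertLevel C Q lam n q = n + 1 + lam q := by
  rw [insertLevel, if_neg hq, if_neg hQ]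

theorem le_insertLevel (hq : q ∉ C) : n ≤ insertLevel C Q lam n q := by
  by_cases hQ : q ∈ Q
  · rw [insertLevel_of_mem_right hq hQ]
  · rw [insertLevel_of_notMem hq hQ]
    omega

end InsertLevel

variable {I : Type uI} {A : I → Type uA} (Γ : DynamicGame I A)

/-! ### Representing utility functions -/

theorem finite_terminal : Finite Γ.Terminal :=
  (Γ.finite_X.subset (s := Γ.X) subset_rfl).to_subtype.of_injective
    (fun z : Γ.Terminal => (⟨z.1, z.2.1⟩ : Γ.X)) (fun z z' h => Subtype.ext (by simpa using h))

/-- The number of outcomes that `i` weakly disprefers to `z`. -/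
def rank (i : I) (z : Γ.Terminal) : ℕ := {z' | Γ.pref i z z'}.ncard

theorem rank_le_rank (i : I) (z z' : Γ.Terminal) : Γ.rank i z' ≤ Γ.rank i z ↔ Γ.pref i z z' := by
  have := Γ.finite_terminal
  constructor
  · intro h
    by_contra hzz
    have hz : Γ.pref i z' z := (Γ.pref_total i z z').resolve_left hzz
    refine absurd h (not_le.2 (Set.ncard_lt_ncard ⟨?_, fun hs => hzz (hs ?_)⟩))
    · exact fun w hw => Γ.pref_trans i _ _ _ hz hw
    · exact (Γ.pref_total i z' z').elim id id
  · intro h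
    exact Set.ncard_le_ncard fun w hw => Γ.pref_trans i _ _ _ h hw

/-- The utility function `z ↦ -M ^ (-rank z)`, very risk averse when `M` is large. -/
def powUtility (M : ℝ) (i : I) (z : Γ.Terminal) : ℝ := -(M ^ Γ.rank i z)⁻¹

theorem powUtility_mem_utilities {M : ℝ} (hM : 1 < M) (i : I) :
    Γ.powUtility M i ∈ Γ.utilities i := by
  intro z z'
  have hM0 : 0 < M := one_pos.trans hM
  rw [powUtility, powUtility, neg_le_neg_iff, inv_le_inv₀ (by positivity) (by positivity),
    pow_le_pow_iff_right₀ hM, rank_le_rank]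

section Procedures

variable {Γ} {i : I}

theorem condEvent_nonempty (E : Γ.condEvents i) : E.1.Nonempty := by
  obtain ⟨_, h, hh, rfl⟩ := E
  exact Γ.reachOpp_nonempty hh

/-- `R_{-i}`. -/
def oppSet (R : ∀ j, Set (Γ.Strategy j)) (i : I) : Set (Γ.Opp i) := {q | ∀ j, q j ∈ R j.1}

theorem oppSet_mono {R R' : ∀ j, Set (Γ.Strategy j)} (h : R ≤ R') (i : I) :
    oppSet R i ⊆ oppSet R' i := fun _ hq j => h j.1 (hq j)

variable [Finite I] [∀ i, Finite (A i)]

/-! ### Beliefs induced by a level function and positive weights -/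

theorem prob_pos {w : Γ.Opp i → ℝ} (hw : ∀ q, 0 < w q) {E : Set (Γ.Opp i)} (hE : E.Nonempty) :
    0 < Γ.prob w E := by
  obtain ⟨q, hq⟩ := hE
  refine Finset.sum_pos' (fun p _ => Set.indicator_nonneg (fun p _ => (hw p).le) p)
    ⟨q, Finset.mem_univ q, ?_⟩
  rw [Set.indicator_of_mem hq]
  exact hw q

/-- The weights `w` conditioned on the elements of `E` of least level. -/
def levelBelief (lam : Γ.Opp i → ℕ) (w : Γ.Opp i → ℝ) (E : Set (Γ.Opp i)) : Γ.Opp i → ℝ :=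
  fun q => (topLevel lam E).indicator w q / Γ.prob w (topLevel lam E)

theorem prob_levelBelief (lam : Γ.Opp i → ℕ) (w : Γ.Opp i → ℝ) (E B : Set (Γ.Opp i)) :
    Γ.prob (levelBelief lam w E) B =
      Γ.prob w (B ∩ topLevel lam E) / Γ.prob w (topLevel lam E) := by
  conv_lhs => rw [prob]
  rw [show Γ.prob w (B ∩ topLevel lam E) = ∑ q, (B ∩ topLevel lam E).indicator w q from rfl,
    Finset.sum_div]
  refine Finset.sum_congr rfl fun q _ => ?_
  by_cases hB : q ∈ B <;> by_cases hT : q ∈ topLevel lam E <;> simp [levelBelief, hB, hT]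

theorem prob_levelBelief_eq_one {lam : Γ.Opp i → ℕ} {w : Γ.Opp i → ℝ} (hw : ∀ q, 0 < w q)
    {E B : Set (Γ.Opp i)} (hE : E.Nonempty) (hB : topLevel lam E ⊆ B) :
    Γ.prob (levelBelief lam w E) B = 1 := by
  rw [prob_levelBelief, Set.inter_eq_right.2 hB]
  exact div_self (prob_pos hw (topLevel_nonempty lam hE)).ne'

theorem isCPS_levelBelief (lam : Γ.Opp i → ℕ) {w : Γ.Opp i → ℝ} (hw : ∀ q, 0 < w q) :
    Γ.IsCPS i (fun E => levelBelief lam w E.1) where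
  measure E := by
    have h0 := prob_pos hw (topLevel_nonempty lam (condEvent_nonempty E))
    refine ⟨fun q => div_nonneg (Set.indicator_nonneg (fun p _ => (hw p).le) q) h0.le, ?_⟩
    have := prob_levelBelief_eq_one (lam := lam) hw (condEvent_nonempty E) (Set.subset_univ _)
    simpa [prob] using this
  self E := prob_levelBelief_eq_one hw (condEvent_nonempty E) fun _ hq => hq.1
  chain E E' B hB hE := by
    simp only [prob_levelBelief]
    -- If `E'` misses the top level of `E`, it has probability zero given `E`, and both sides
    -- vanish.
    by_cases hne : (E'.1 ∩ topLevel lam E.1).Nonempty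
    · rw [topLevel_inter_of_nonempty lam hE hne, ← Set.inter_assoc, Set.inter_eq_left.2 hB,
        div_mul_div_cancel₀ (prob_pos hw hne).ne']
    · rw [Set.not_nonempty_iff_eq_empty] at hne
      have : B ∩ topLevel lam E.1 = ∅ :=
        Set.subset_eq_empty (Set.inter_subset_inter_left _ hB) hne
      rw [hne, this]
      simp [prob]

theorem levelBelief_mem_cpsOn {lam : Γ.Opp i → ℕ} {w : Γ.Opp i → ℝ} (hw : ∀ q, 0 < w q)
    {R : ∀ j, Set (Γ.Strategy j)}
    (hR : ∀ q ∈ oppSet R i, ∀ q' ∉ oppSet R i, lam q < lam q') :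
    (fun E : Γ.condEvents i => levelBelief lam w E.1) ∈ Γ.cpsOn R i := by
  refine ⟨isCPS_levelBelief lam hw, fun h hne => ?_⟩
  refine prob_levelBelief_eq_one hw (condEvent_nonempty (Γ.event h)) fun q hq => ⟨?_, hq.1⟩
  obtain ⟨⟨t, p⟩, -, hpR, hpE⟩ := hne
  by_contra hqR
  exact absurd (hq.2 p hpE) (not_le.2 (hR p hpR q hqR))

/-! ### Best replies to level beliefs. -/

variable [DecidableEq I]

/-- The total weighted utility of `s` against the profiles in `E`. -/
def value (ui : Γ.Terminal → ℝ) (w : Γ.Opp i → ℝ) (E : Set (Γ.Opp i)) (s : Γ.Strategy i) : ℝ :=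
  ∑ q, E.indicator (fun q => w q * ui (Γ.outcome (Γ.glue i s q))) q

theorem value_congr {ui : Γ.Terminal → ℝ} {w : Γ.Opp i → ℝ} {E : Set (Γ.Opp i)}
    {s t : Γ.Strategy i}
    (h : ∀ q ∈ E, Γ.outcome (Γ.glue i s q) = Γ.outcome (Γ.glue i t q)) :
    value ui w E s = value ui w E t := by
  refine Finset.sum_congr rfl fun q _ => ?_
  by_cases hq : q ∈ E <;> simp [hq, h]

/-- When `r` is the replacement of `s` by `t` at an information set with event `E`, this turns a
comparison on a whole level into one on the part of it inside `E`. -/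
theorem value_sub_value {ui : Γ.Terminal → ℝ} {w : Γ.Opp i → ℝ} (S : Set (Γ.Opp i))
    {E : Set (Γ.Opp i)} {r s t : Γ.Strategy i}
    (h1 : ∀ q ∈ E, Γ.outcome (Γ.glue i r q) = Γ.outcome (Γ.glue i t q))
    (h2 : ∀ q ∉ E, Γ.outcome (Γ.glue i r q) = Γ.outcome (Γ.glue i s q)) :
    value ui w S r - value ui w S s = value ui w (S ∩ E) t - value ui w (S ∩ E) s := by
  simp only [value, ← Finset.sum_sub_distrib]
  refine Finset.sum_congr rfl fun q _ => ?_
  by_cases hS : q ∈ S <;> by_cases hE : q ∈ E <;> simp [hS, hE, h1, h2]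

theorem expUtility_levelBelief (ui : Γ.Terminal → ℝ) (lam : Γ.Opp i → ℕ) (w : Γ.Opp i → ℝ)
    (E : Set (Γ.Opp i)) (s : Γ.Strategy i) :
    Γ.expUtility i ui s (levelBelief lam w E) =
      value ui w (topLevel lam E) s / Γ.prob w (topLevel lam E) := by
  rw [expUtility, value, Finset.sum_div]
  refine Finset.sum_congr rfl fun q _ => ?_
  by_cases hT : q ∈ topLevel lam E <;> simp [levelBelief, hT]
  ring

/-- `s` is a best reply at `h` to the belief given by the levels `lam` and the weights `w`. -/
def OptimalAt (ui : Γ.Terminal → ℝ) (lam : Γ.Opp i → ℕ) (w : Γ.Opp i → ℝ)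
    (h : Set (List (∀ i, A i))) (s : Γ.Strategy i) : Prop :=
  ∀ t ∈ Γ.reachOwn i h, value ui w (topLevel lam (Γ.reachOpp i h)) t ≤
    value ui w (topLevel lam (Γ.reachOpp i h)) s

theorem mem_opR_of_optimalAt {u : I → Γ.Terminal → ℝ} {lam : Γ.Opp i → ℕ} {w : Γ.Opp i → ℝ}
    (hw : ∀ q, 0 < w q) {R : ∀ j, Set (Γ.Strategy j)}
    (hR : ∀ q ∈ oppSet R i, ∀ q' ∉ oppSet R i, lam q < lam q') {s : Γ.Strategy i} (hs : s ∈ R i)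
    (hopt : ∀ h ∈ Γ.infoSets i, s ∈ Γ.reachOwn i h → (Γ.condProblem R i h).Nonempty →
      OptimalAt (u i) lam w h s) : s ∈ Γ.opR u R i := by
  refine ⟨hs, _, levelBelief_mem_cpsOn hw hR, fun h hsh hne t ht => ?_⟩
  simp only [expUtility_levelBelief]
  exact div_le_div_of_nonneg_right (hopt h.1 h.2 hsh hne t ht)
    (prob_pos hw (topLevel_nonempty lam (condEvent_nonempty (Γ.event h)))).le

/-- A single belief serves in all rounds at once, because `lam` puts the survivors of each earlier
round strictly below the rest. -/
theorem mem_strongRat_of_optimalAt {u : I → Γ.Terminal → ℝ} {lam : Γ.Opp i → ℕ}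
    {w : Γ.Opp i → ℝ} (hw : ∀ q, 0 < w q) {s : Γ.Strategy i}
    (hopt : ∀ h ∈ Γ.infoSets i, s ∈ Γ.reachOwn i h → OptimalAt (u i) lam w h s) (k : ℕ)
    (hR : ∀ m < k, ∀ q ∈ oppSet (Γ.strongRat u m) i, ∀ q' ∉ oppSet (Γ.strongRat u m) i,
      lam q < lam q') : s ∈ Γ.strongRat u k i := by
  induction k with
  | zero => exact Set.mem_univ s
  | succ k ih =>
    exact mem_opR_of_optimalAt hw (hR k k.lt_succ_self) (ih fun m hm => hR m (hm.trans k.lt_succ_self))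
      fun h hh hsh _ => hopt h hh hsh

theorem strongRat_antitone (u : I → Γ.Terminal → ℝ) : Antitone (Γ.strongRat u) :=
  antitone_nat_of_succ_le fun _ _ _ hs => hs.1

/-- The level of `q` counts the rounds up to `k` that exclude it. -/
theorem exists_level_of_antitone {α : Type*} {Q : ℕ → Set α} (hQ : Antitone Q) (k : ℕ) :
    ∃ lam : α → ℕ, ∀ m ≤ k, ∀ q ∈ Q m, ∀ q' ∉ Q m, lam q < lam q' := by
  classical
  refine ⟨fun q => ((Finset.range (k + 1)).filter fun m => q ∉ Q m).card,
    fun m hm q hq q' hq' => Finset.card_lt_card ⟨fun l hl => ?_, fun hs => ?_⟩⟩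
  · simp only [Finset.mem_filter, Finset.mem_range] at hl ⊢
    have hml : m ≤ l := by
      by_contra hlt
      exact hl.2 (hQ (not_le.1 hlt).le hq)
    exact ⟨hl.1, fun h => hq' (hQ hml h)⟩
  · have hmem : m ∈ (Finset.range (k + 1)).filter fun m => q' ∉ Q m := by
      simp only [Finset.mem_filter, Finset.mem_range]
      exact ⟨by omega, hq'⟩
    exact (Finset.mem_filter.1 (hs hmem)).2 hq

/-! ### Undominated strategies are best replies -/

theorem opR_subset_opU {u : I → Γ.Terminal → ℝ} (hu : u i ∈ Γ.utilities i)
    (R : ∀ j, Set (Γ.Strategy j)) : Γ.opR u R i ⊆ Γ.opU R i := by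
  rintro s ⟨hs, μ, ⟨hμ, hμR⟩, hopt⟩
  refine ⟨hs, fun h hh hsh hne hdom => ?_⟩
  set p := μ (Γ.event ⟨h, hh⟩) with hp
  have hp0 : ∀ q, 0 ≤ p q := (hμ.measure _).1
  have hp1 : Γ.prob p (Γ.restOpp R i h) = 1 := hμR ⟨h, hh⟩ hne
  have hsupp : ∀ q, p q ≠ 0 → q ∈ Γ.restOpp R i h := by
    intro q hq
    by_contra hqR
    have h1 : ∑ q, p q = 1 := (hμ.measure _).2
    have h2 : Γ.prob p (Γ.restOpp R i h) < ∑ q, p q := by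
      refine Finset.sum_lt_sum (fun q _ => Set.indicator_le_self' (fun q _ => hp0 q) q)
        ⟨q, Finset.mem_univ q, ?_⟩
      rw [Set.indicator_of_notMem hqR]
      exact lt_of_le_of_ne (hp0 q) hq.symm
    linarith
  have hQne : {q | p q ≠ 0}.Nonempty := by
    by_contra H
    rw [Set.not_nonempty_iff_eq_empty] at H
    have h1 : ∑ q, p q = 1 := (hμ.measure _).2
    have h0 : ∀ q, p q = 0 := fun q => by
      by_contra hq
      exact (Set.eq_empty_iff_forall_notMem.1 H q) hq
    simp [h0] at h1
  -- Test B-dominance on the support of the belief: a weak dominator there would have strictly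
  -- higher expected utility.
  refine hdom.2 {q | p q ≠ 0} hsupp hQne ⟨hdom.1, fun t ht ⟨hle, q, hq, hq1, hq2⟩ => ?_⟩
  have hs_le := hopt ⟨h, hh⟩ hsh hne t ht.2
  refine absurd hs_le (not_le.2 ?_)
  refine Finset.sum_lt_sum (fun q _ => ?_) ⟨q, Finset.mem_univ q, ?_⟩
  · by_cases hq : p q = 0
    · rw [← hp, hq]
      simp
    · exact mul_le_mul_of_nonneg_right ((hu _ _).2 (hle q hq)) (hp0 q)
  · refine mul_lt_mul_of_pos_right ?_ (lt_of_le_of_ne (hp0 q) (Ne.symm hq))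
    exact lt_of_not_ge fun hge => hq2 ((hu _ _).1 hge)

/-- Each profile in `Q` costs `s` exactly `1`, in total at most `M`, whereas a single profile where
`t` does worse costs `t` at least `M`. If there is none, admissibility forces `t` and `s` to be
indifferent throughout `Q`. -/
theorem value_le_value_of_admissible {M : ℝ} (hM : 1 < M)
    (hcard : (Fintype.card (Γ.Opp i) : ℝ) ≤ M) {P : Set (Γ.Strategy i)} {Q : Set (Γ.Opp i)}
    {s t : Γ.Strategy i} (hs : s ∈ Γ.admissible i P Q) (ht : t ∈ P) :
    value (Γ.powUtility M i) (fun q => M ^ Γ.rank i (Γ.outcome (Γ.glue i s q))) Q t ≤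
      value (Γ.powUtility M i) (fun q => M ^ Γ.rank i (Γ.outcome (Γ.glue i s q))) Q s := by
  have hM0 : 0 < M := one_pos.trans hM
  by_cases H : ∃ q ∈ Q, Γ.rank i (Γ.outcome (Γ.glue i t q)) < Γ.rank i (Γ.outcome (Γ.glue i s q))
  · obtain ⟨q, hq, hlt⟩ := H
    have h1 : -M ≤ value (Γ.powUtility M i)
        (fun q => M ^ Γ.rank i (Γ.outcome (Γ.glue i s q))) Q s := by
      have : ∑ _q : Γ.Opp i, (-1 : ℝ) ≤ value (Γ.powUtility M i)
          (fun q => M ^ Γ.rank i (Γ.outcome (Γ.glue i s q))) Q s := by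
        refine Finset.sum_le_sum fun q _ => ?_
        by_cases hq : q ∈ Q
        · rw [Set.indicator_of_mem hq, powUtility, mul_neg, mul_inv_cancel₀ (by positivity)]
        · rw [Set.indicator_of_notMem hq]
          norm_num
      simp only [Finset.sum_const, Finset.card_univ, nsmul_eq_mul] at this
      linarith
    refine le_trans ?_ h1
    have h2 : ∀ p, Q.indicator (fun q => M ^ Γ.rank i (Γ.outcome (Γ.glue i s q)) *
        Γ.powUtility M i (Γ.outcome (Γ.glue i t q))) p ≤ 0 := by
      refine fun p => Set.indicator_nonpos (fun p _ => ?_) p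
      rw [powUtility, mul_neg, neg_nonpos]
      positivity
    classical
    -- All terms are nonpositive, so the one at `q` bounds the sum from above.
    rw [value, ← Finset.add_sum_erase _ _ (Finset.mem_univ q)]
    refine (add_le_of_nonpos_right (Finset.sum_nonpos fun p _ => h2 p)).trans ?_
    rw [Set.indicator_of_mem hq, powUtility, mul_neg, neg_le_neg_iff,
      ← div_eq_mul_inv, le_div_iff₀ (by positivity), ← pow_succ']
    exact pow_le_pow_right₀ hM.le hlt
  · push Not at H
    refine (Finset.sum_congr rfl fun q _ => ?_).le
    by_cases hq : q ∈ Q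
    · have h1 : Γ.rank i (Γ.outcome (Γ.glue i t q)) ≤ Γ.rank i (Γ.outcome (Γ.glue i s q)) := by
        by_contra h
        refine hs.2 t ht ⟨fun q hq => (Γ.rank_le_rank i _ _).1 (H q hq), q, hq,
          (Γ.rank_le_rank i _ _).1 (H q hq), fun h' => h ((Γ.rank_le_rank i _ _).2 h')⟩
      rw [Set.indicator_of_mem hq, Set.indicator_of_mem hq, powUtility, powUtility,
        le_antisymm h1 (H q hq)]
    · rw [Set.indicator_of_notMem hq, Set.indicator_of_notMem hq]

end Procedures

end

section

section Procedures
variable {I : Type uI} {A : I → Type uA} {Γ : DynamicGame I A}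
variable [DecidableEq I] [Finite I] [∀ i, Finite (A i)] {i : I}

/-! ### Building beliefs level by level -/

/-- Beliefs have been assigned to the profiles in `C ⊆ R_{-i}`, at levels below `n`, in such a way
that `s` is optimal at each of its information sets that are reached by `C`, where `R` is the
`k`-th round of Strong Rationalizability; `lam` respects the earlier rounds. -/
structure PartialLevels (u : I → Γ.Terminal → ℝ) (k : ℕ) (w : Γ.Opp i → ℝ) (s : Γ.Strategy i)
    (C : Set (Γ.Opp i)) (lam : Γ.Opp i → ℕ) (n : ℕ) : Prop where
  subset : C ⊆ oppSet (Γ.strongRat u k) i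
  lt : ∀ q ∈ C, lam q < n
  le : ∀ q ∉ C, n ≤ lam q
  sep : ∀ m ≤ k, ∀ q ∈ oppSet (Γ.strongRat u m) i, ∀ q' ∉ oppSet (Γ.strongRat u m) i,
    lam q < lam q'
  opt : ∀ g ∈ Γ.infoSets i, s ∈ Γ.reachOwn i g → (C ∩ Γ.reachOpp i g).Nonempty →
    OptimalAt (u i) lam w g s

theorem exists_partialLevels_empty (u : I → Γ.Terminal → ℝ) (k : ℕ) (w : Γ.Opp i → ℝ)
    (s : Γ.Strategy i) : ∃ lam, PartialLevels u k w s ∅ lam 0 := by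
  obtain ⟨lam, hlam⟩ := exists_level_of_antitone
    (Q := fun m => oppSet (Γ.strongRat u m) i)
    (fun _ _ hmn => oppSet_mono (strongRat_antitone u hmn) i) k
  exact ⟨lam, Set.empty_subset _, fun _ hq => hq.elim, fun _ _ => Nat.zero_le _, hlam,
    fun g _ _ h => by simp at h⟩

/-- Maximizing level by level yields one strategy that is optimal at all its information sets
simultaneously, up to the constraints imposed by `T`. -/
theorem exists_lex_max {α : Type*} [Finite α] (V : α → ℕ → ℝ) {T : Set α} (hT : T.Nonempty) :
    ∃ t ∈ T, ∀ r ∈ T, ∀ n, (∀ j < n, V r j = V t j) → V r n ≤ V t n := by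
  obtain ⟨t, ht, hmax⟩ := Set.exists_max_image T (fun r => toLex (V r)) T.toFinite hT
  refine ⟨t, ht, fun r hr n hj => ?_⟩
  by_contra hlt
  refine absurd (hmax r hr) (not_le.2 ⟨n, fun j hjn => (hj j hjn).symm, not_le.1 hlt⟩)

variable {u : I → Γ.Terminal → ℝ} {k n : ℕ} {w : Γ.Opp i → ℝ} {s : Γ.Strategy i}
  {C Q : Set (Γ.Opp i)} {lam : Γ.Opp i → ℕ}

/-- Only survivors of round `k` are moved to low levels; the others keep their relative order under
the shift by `n + 1`. -/
theorem PartialLevels.insertLevel_sep (hp : PartialLevels u k w s C lam n)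
    (hQ : Q ⊆ oppSet (Γ.strongRat u k) i) (m : ℕ) (hm : m ≤ k) (q : Γ.Opp i)
    (hq : q ∈ oppSet (Γ.strongRat u m) i) (q' : Γ.Opp i)
    (hq' : q' ∉ oppSet (Γ.strongRat u m) i) :
    insertLevel C Q lam n q < insertLevel C Q lam n q' := by
  have hsub := oppSet_mono (strongRat_antitone u hm) i
  rw [insertLevel_of_notMem (fun h => hq' (hsub (hp.subset h))) (fun h => hq' (hsub (hQ h)))]
  have h1 := hp.sep m hm q hq q' hq'
  by_cases hqC : q ∈ C
  · rw [insertLevel_of_mem hqC]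
    omega
  by_cases hqQ : q ∈ Q
  · rw [insertLevel_of_mem_right hqC hqQ]
    omega
  · rw [insertLevel_of_notMem hqC hqQ]
    omega

theorem PartialLevels.insertLevel_fiber (hp : PartialLevels u k w s C lam n)
    (hQC : Disjoint Q C) : {q | insertLevel C Q lam n q = n} = Q := by
  ext q
  rw [Set.mem_ofPred_eq]
  by_cases hqC : q ∈ C
  · rw [insertLevel_of_mem hqC]
    exact ⟨fun h => absurd h (hp.lt q hqC).ne, fun h => absurd hqC (hQC.notMem_of_mem_left h)⟩
  by_cases hqQ : q ∈ Q
  · simp [insertLevel_of_mem_right hqC hqQ, hqQ]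
  · rw [insertLevel_of_notMem hqC hqQ]
    exact ⟨fun h => by omega, fun h => absurd h hqQ⟩

theorem PartialLevels.insertLevel_topLevel (hp : PartialLevels u k w s C lam n)
    {E : Set (Γ.Opp i)} (hE : (C ∩ E).Nonempty) :
    topLevel (insertLevel C Q lam n) E = topLevel lam E :=
  topLevel_congr hp.lt hp.le (fun _ hq => le_insertLevel hq) (fun _ hq => insertLevel_of_mem hq) hE

/-- If a strategy that agrees with `s` against `C` beat `s` at `h`, then some strategy in the
`k`-th round of Strong Rationalizability would do so too. -/
theorem PartialLevels.exists_better (hp : PartialLevels u k w s C lam n) (hw : ∀ q, 0 < w q)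
    {h : Set (List (∀ i, A i))} (hh : h ∈ Γ.infoSets i) (hsh : s ∈ Γ.reachOwn i h)
    (hC : Disjoint C (Γ.reachOpp i h))
    (hmin : ∀ g ∈ Γ.infoSets i, Precedes g h → (C ∩ Γ.reachOpp i g).Nonempty)
    (hQ : Q ⊆ oppSet (Γ.strongRat u k) i) (hQh : Q ⊆ Γ.reachOpp i h)
    {t : Γ.Strategy i} (ht : t ∈ Γ.reachOwn i h) (hlt : value (u i) w Q s < value (u i) w Q t) :
    ∃ r ∈ Γ.strongRat u k i ∩ Γ.reachOwn i h, value (u i) w Q s < value (u i) w Q r := by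
  have hQC : Disjoint Q C := (hC.mono_right hQh).symm
  set lam' := insertLevel C Q lam n with hlam'
  -- Agreement with `s` against `C` lets the maximizer inherit the optimality of `s` wherever `C`
  -- determines the belief.
  let T : Set (Γ.Strategy i) := {t | t ∈ Γ.reachOwn i h ∧
    ∀ q ∈ C, Γ.outcome (Γ.glue i t q) = Γ.outcome (Γ.glue i s q)}
  obtain ⟨r, ⟨hrh, hrC⟩, hmax⟩ := exists_lex_max
    (fun t l => value (u i) w {q | lam' q = l} t) (T := T) ⟨s, hsh, fun _ _ => rfl⟩
  refine ⟨r, ⟨mem_strongRat_of_optimalAt (u := u) (lam := lam') hw ?_ k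
    fun m hm => hp.insertLevel_sep hQ m hm.le, hrh⟩, ?_⟩
  · intro g hg hrg t' ht'
    by_cases hCg : (C ∩ Γ.reachOpp i g).Nonempty
    · have hsg : s ∈ Γ.reachOwn i g := by
        obtain ⟨q, hqC, hqg⟩ := hCg
        have := Γ.glue_mem_reach hg hrg hqg
        apply Γ.mem_reachOwn_of_glue (q := q)
        rw [reach, Set.mem_ofPred_eq] at this ⊢
        rwa [← hrC q hqC]
      have hsub := topLevel_subset_of_lt hp.lt hp.le hCg
      rw [hp.insertLevel_topLevel hCg, value_congr fun q hq => hrC q (hsub hq)]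
      exact hp.opt g hg hsg hCg t' ht'
    · obtain ⟨r', hr'g, h1, h2⟩ := Γ.exists_replacement hg hrg ht'
      have hr'C : ∀ q ∈ C, Γ.outcome (Γ.glue i r' q) = Γ.outcome (Γ.glue i r q) :=
        fun q hq => h2 q fun hqg => hCg ⟨q, hq, hqg⟩
      -- `g` cannot precede `h`, since `C` would then reach `g`; and if no opponents' profile
      -- reaches both, the change at `g` does not affect the way to `h`.
      have hr'h : r' ∈ Γ.reachOwn i h := by
        by_cases hgh : (Γ.reachOpp i g ∩ Γ.reachOpp i h).Nonempty
        · obtain ⟨q, hqg, hqh⟩ := hgh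
          rcases Γ.precedes_cases_of_reach hg hh hrg hrh hqg hqh with rfl | hgh | hgh
          · exact hr'g
          · exact absurd (hmin g hg hgh) hCg
          · exact hgh.reachOwn_subset hh hg hr'g
        · obtain ⟨q, hq⟩ := Γ.reachOpp_nonempty hh
          have := Γ.glue_mem_reach hh hrh hq
          apply Γ.mem_reachOwn_of_glue (q := q)
          rw [reach, Set.mem_ofPred_eq] at this ⊢
          rwa [h2 q fun hqg => hgh ⟨q, hqg, hq⟩]
      -- Below the top level of `S_{-i}(g)` all profiles lie outside this event, so `r'` and `r` tie
      -- there and the lexicographic comparison is decided at the level of `p`.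
      obtain ⟨p, hpt⟩ := topLevel_nonempty lam' (Γ.reachOpp_nonempty hg)
      have hle := hmax r' ⟨hr'h, fun q hq => (hr'C q hq).trans (hrC q hq)⟩ (lam' p) fun j hj =>
        value_congr fun q hq => h2 q fun hqg => by
          have h3 := hpt.2 q hqg
          rw [Set.mem_ofPred_eq] at hq
          omega
      have := value_sub_value (ui := u i) (w := w) {q | lam' q = lam' p} h1 h2
      rw [← topLevel_eq_fiber lam' hpt] at this
      linarith
  · obtain ⟨r', hr'h, h1, h2⟩ := Γ.exists_replacement hh hsh ht
    have hr'C : ∀ q ∈ C, Γ.outcome (Γ.glue i r' q) = Γ.outcome (Γ.glue i s q) :=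
      fun q hq => h2 q (hC.notMem_of_mem_left hq)
    -- Levels below `n` contain only `C`, where all of `T` ties; level `n` is exactly `Q`.
    have hle := hmax r' ⟨hr'h, hr'C⟩ n fun j hj => value_congr fun q hq => by
      have hqC : q ∈ C := by
        by_contra hqC
        have hle : n ≤ lam' q := le_insertLevel hqC
        rw [Set.mem_ofPred_eq] at hq
        omega
      rw [hr'C q hqC, hrC q hqC]
    simp only [hlam', hp.insertLevel_fiber hQC] at hle
    rw [value_congr fun q hq => h1 q (hQh hq)] at hle
    exact hlt.trans_le hle

/-- The profiles in `Q` can be given the next level, if `s` is optimal at `h` against them. -/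
theorem PartialLevels.insert (hp : PartialLevels u k w s C lam n)
    {h : Set (List (∀ i, A i))} (hh : h ∈ Γ.infoSets i) (hsh : s ∈ Γ.reachOwn i h)
    (hC : Disjoint C (Γ.reachOpp i h))
    (hmin : ∀ g ∈ Γ.infoSets i, Precedes g h → (C ∩ Γ.reachOpp i g).Nonempty)
    (hQ : Q ⊆ oppSet (Γ.strongRat u k) i) (hQh : Q ⊆ Γ.reachOpp i h)
    (hopt : ∀ t ∈ Γ.reachOwn i h, value (u i) w Q t ≤ value (u i) w Q s) :
    PartialLevels u k w s (C ∪ Q) (insertLevel C Q lam n) (n + 1) where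
  subset := Set.union_subset hp.subset hQ
  lt q hq := by
    by_cases hqC : q ∈ C
    · rw [insertLevel_of_mem hqC]
      exact (hp.lt q hqC).trans n.lt_succ_self
    · rw [insertLevel_of_mem_right hqC (hq.resolve_left hqC)]
      exact n.lt_succ_self
  le q hq := by
    rw [insertLevel_of_notMem (fun h => hq (Or.inl h)) (fun h => hq (Or.inr h))]
    omega
  sep := hp.insertLevel_sep hQ
  opt g hg hsg hne t ht := by
    by_cases hCg : (C ∩ Γ.reachOpp i g).Nonempty
    · rw [hp.insertLevel_topLevel hCg]
      exact hp.opt g hg hsg hCg t ht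
    · have hQC : Disjoint Q C := (hC.mono_right hQh).symm
      obtain ⟨p, hpCQ, hpg⟩ := hne
      have hpC : p ∉ C := fun h => hCg ⟨p, h, hpg⟩
      have hpQ : p ∈ Q := hpCQ.resolve_left hpC
      have hpn : insertLevel C Q lam n p = n := insertLevel_of_mem_right hpC hpQ
      have hpt : p ∈ topLevel (insertLevel C Q lam n) (Γ.reachOpp i g) :=
        ⟨hpg, fun q hq => hpn.le.trans (le_insertLevel fun hqC => hCg ⟨q, hqC, hq⟩)⟩
      rw [topLevel_eq_fiber _ hpt, hpn, hp.insertLevel_fiber hQC]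
      obtain ⟨r, hrg, h1, h2⟩ := Γ.exists_replacement hg hsg ht
      -- A deviation at `g` must remain in `S_i(h)` for `hopt` to apply; the profile `p`, which
      -- reaches both, makes `g` and `h` comparable.
      have hrh : r ∈ Γ.reachOwn i h := by
        rcases Γ.precedes_cases_of_reach hg hh hsg hsh hpg (hQh hpQ) with rfl | hgh | hgh
        · exact hrg
        · exact absurd (hmin g hg hgh) hCg
        · exact hgh.reachOwn_subset hh hg hrg
      have := value_sub_value (ui := u i) (w := w) Q h1 h2
      linarith [hopt r hrh]

/-! ### Equality of the two procedures. -/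

theorem opU_subset_opR {M : ℝ} (hM : 1 < M) (hcard : ∀ i, (Fintype.card (Γ.Opp i) : ℝ) ≤ M)
    (k : ℕ) : Γ.opU (Γ.strongRat (Γ.powUtility M) k) i ⊆
      Γ.opR (Γ.powUtility M) (Γ.strongRat (Γ.powUtility M) k) i := by
  intro s hs
  set u := Γ.powUtility M with hu
  set w : Γ.Opp i → ℝ := fun q => M ^ Γ.rank i (Γ.outcome (Γ.glue i s q)) with hw'
  have hw : ∀ q, 0 < w q := fun q => pow_pos (one_pos.trans hM) _
  obtain ⟨lam₀, h₀⟩ := exists_partialLevels_empty u k w s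
  -- A largest assignment reaches every relevant information set; otherwise another level could be
  -- added.
  obtain ⟨C, ⟨lam, n, hp⟩, hmax⟩ := Set.exists_max_image
    {C | ∃ lam n, PartialLevels u k w s C lam n} Set.ncard (Set.toFinite _) ⟨∅, lam₀, 0, h₀⟩
  have hcov : ∀ h ∈ Γ.infoSets i, s ∈ Γ.reachOwn i h →
      (Γ.restOpp (Γ.strongRat u k) i h).Nonempty → (C ∩ Γ.reachOpp i h).Nonempty := by
    by_contra! H
    -- Least depth ensures that `C` already reaches all predecessors of `h`.
    obtain ⟨h, ⟨hh, hsh, hne, hC⟩, hmin⟩ := (measure depth).wf.has_min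
      {h | h ∈ Γ.infoSets i ∧ s ∈ Γ.reachOwn i h ∧ (Γ.restOpp (Γ.strongRat u k) i h).Nonempty ∧
        C ∩ Γ.reachOpp i h = ∅}
      (by obtain ⟨h, h1, h2, h3, h4⟩ := H; exact ⟨h, h1, h2, h3, h4⟩)
    have hmin' : ∀ g ∈ Γ.infoSets i, Precedes g h → (C ∩ Γ.reachOpp i g).Nonempty := by
      intro g hg hgh
      by_contra hCg
      exact hmin g ⟨hg, hgh.reachOwn_subset hg hh hsh,
        hne.mono (Set.inter_subset_inter_right _ (hgh.reachOpp_subset hg hh)),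
        Set.not_nonempty_iff_eq_empty.1 hCg⟩ (hgh.depth_lt hg hh)
    have hsR : s ∈ Γ.restOwn (Γ.strongRat u k) i h := ⟨hs.1, hsh⟩
    have hnd := hs.2 h hh hsh (Set.Nonempty.prod ⟨s, hsR⟩ hne)
    obtain ⟨Q, hQ, ⟨p, hpQ⟩, hadm⟩ : ∃ Q ⊆ Γ.restOpp (Γ.strongRat u k) i h, Q.Nonempty ∧
        s ∈ Γ.admissible i (Γ.restOwn (Γ.strongRat u k) i h) Q := by
      by_contra! H'
      exact hnd ⟨hsR, H'⟩
    have hCd : Disjoint C (Γ.reachOpp i h) := Set.disjoint_iff_inter_eq_empty.2 hC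
    have hext := hp.insert hh hsh hCd hmin' (fun q hq => (hQ hq).1) (fun q hq => (hQ hq).2) <| by
      intro t ht
      by_contra hlt
      -- A rival from `S_i(h)` is exchanged for one in `R_i(h)`, to which admissibility applies.
      obtain ⟨r, hr, hlt'⟩ := hp.exists_better hw hh hsh hCd hmin' (fun q hq => (hQ hq).1)
        (fun q hq => (hQ hq).2) ht (not_le.1 hlt)
      exact absurd (value_le_value_of_admissible hM (hcard i) hadm hr) (not_le.2 hlt')
    refine absurd (hmax _ ⟨_, _, hext⟩) (not_le.2 (Set.ncard_lt_ncard ?_))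
    refine ⟨Set.subset_union_left, fun hsub => ?_⟩
    exact hCd.notMem_of_mem_left (hsub (Or.inr hpQ)) (hQ hpQ).2
  refine mem_opR_of_optimalAt (u := u) hw (hp.sep k le_rfl) hs.1 fun h hh hsh hne => ?_
  exact hp.opt h hh hsh (hcov h hh hsh (Set.prod_nonempty_iff.1 hne).2)

end Procedures

end

end DynamicGame

end

theorem mainTheorem4 {I : Type*} [Finite I] [DecidableEq I] {A : I → Type*} [∀ i, Finite (A i)]
    (Γ : DynamicGame I A) :
    ∃ u : I → Γ.Terminal → ℝ, (∀ i, u i ∈ Γ.utilities i) ∧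
      ∀ (i : I) (k : ℕ), Γ.icbd k i = Γ.strongRat u k i := by
  classical
  have := Fintype.ofFinite I
  obtain ⟨M, hM, hcard⟩ : ∃ M : ℝ, 1 < M ∧ ∀ i, (Fintype.card (Γ.Opp i) : ℝ) ≤ M := by
    have h0 : ∀ i, (0 : ℝ) ≤ Fintype.card (Γ.Opp i) := fun i => Nat.cast_nonneg _
    refine ⟨2 + ∑ i, (Fintype.card (Γ.Opp i) : ℝ), ?_, fun i => ?_⟩
    · linarith [Finset.sum_nonneg fun i (_ : i ∈ Finset.univ) => h0 i]
    · linarith [Finset.single_le_sum (fun i _ => h0 i) (Finset.mem_univ i)]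
  have hu := DynamicGame.powUtility_mem_utilities Γ hM
  refine ⟨Γ.powUtility M, hu, fun i k => ?_⟩
  suffices h : Γ.icbd k = Γ.strongRat (Γ.powUtility M) k by rw [h]
  induction k with
  | zero => rfl
  | succ k ih =>
    funext i
    rw [DynamicGame.icbd, ih]
    exact (DynamicGame.opU_subset_opR hM hcard k).antisymm
      (DynamicGame.opR_subset_opU (hu i) _)
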